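/- Write $(x)_n=x(x+1)\cdots(x+n-1)$ with $(x)_0=1$, and $(x_1,\dots,x_m)_n=(x_1)_n\cdots(x_m)_n$; ${}_2F_1$ and ${}_3F_2$ denote the usual hypergeometric series $${}_2F_1\left({a,b\atop c};z\right)=\sum_{k\ge0}\frac{(a,b)_k}{(c)_k\,k!}z^k,\qquad {}_3F_2\left({a_1,a_2,a_3\atop b_1,b_2};z\right)=\sum_{k\ge0}\frac{(a_1,a_2,a_3)_k}{(b_1,b_2)_k\,k!}z^k .$$ Theorem (multiplication formula for ${}_2F_1$). Let $a,b,c,a',b',c'\in\mathbb C$ be such that none of $c$, $c'$, $c+c'$ belongs to $\{0,-1,-2,\dots\}$, and let $z\in\mathbb C$ with $|z|<1$. Then $${}_2F_1\left({a,b\atop c};z\right)\,{}_2F_1\left({a',b'\atop c'};z\right)=\sum_{j=0}^\infty C_j\,z^j\,{}_2F_1\left({a+a'+j,\;b+b'+j\atop c+c'+2j};z\right),$$ where the series on the right converges absolutely and $$C_j=\frac{(c,a+a',b+b')_j}{j!\,(c',c+c'+j-1)_j}\;{}_3F_2\left({-j,a,c+c'+j-1\atop a+a',c};1\right)\,{}_3F_2\left({-j,b,c+c'+j-1\atop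 b+b',c};1\right).$$ If $a+a'$ or $b+b'$ is one of $0,-1,\dots,-(j-1)$, then $C_j$ is understood with the factors $(a+a')_j/(a+a')_k$ and $(b+b')_j/(b+b')_k$, $0\le k\le j$, cancelled, that is, $$C_j=\frac{(c)_j}{j!\,(c',c+c'+j-1)_j}\left(\sum_{k=0}^j\frac{(-j,a,c+c'+j-1)_k\,(a+a'+k)_{j-k}}{(c)_k\,k!}\right)\left(\sum_{k=0}^j\frac{(-j,b,c+c'+j-1)_k\,(b+b'+k)_{j-k}}{(c)_k\,k!}\right).$$ For each $j$, this expression agrees with the previous one whenever $(a+a')_j\neq0$ and $(b+b')_j\ne0$, and in every case it is the limit of the previous one as $(\tilde a,\tilde b,\tilde a',\tilde b')\to(a,b,a',b')$ through parameters with $(\tilde a+\tilde a')_j\ne0$ and $(\tilde b+\tilde b')_j\neq0$ (with $c,c'$ fixed). -/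

import Mathlib

open Filter Topology
open scoped Nat

noncomputable section

/-- The Pochhammer symbol `(x)_n = x (x + 1) ⋯ (x + n - 1)`, with `(x)_0 = 1`. -/
abbrev poch (x : ℂ) (n : ℕ) : ℂ := (ascPochhammer ℂ n).eval x

/-- The hypergeometric series
`₃F₂(a₁, a₂, a₃; b₁, b₂; z) = ∑ₖ (a₁)ₖ (a₂)ₖ (a₃)ₖ / ((b₁)ₖ (b₂)ₖ k!) zᵏ`. -/
def hyp₃F₂ (a₁ a₂ a₃ b₁ b₂ z : ℂ) : ℂ :=
  ∑' k : ℕ, poch a₁ k * poch a₂ k * poch a₃ k / (poch b₁ k * poch b₂ k * (k ! : ℂ)) * z ^ k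

/-- The coefficient `C_j` as the quotient of Pochhammer symbols times two terminating `₃F₂(1)`.
It is meaningful as it stands when neither `a + a'` nor `b + b'` is one of `0, -1, …, -(j - 1)`. -/
def quotientCoeff (a b c a' b' c' : ℂ) (j : ℕ) : ℂ :=
  poch c j * poch (a + a') j * poch (b + b') j /
      ((j ! : ℂ) * (poch c' j * poch (c + c' + j - 1) j)) *
    hyp₃F₂ (-(j : ℂ)) a (c + c' + j - 1) (a + a') c 1 *
    hyp₃F₂ (-(j : ℂ)) b (c + c' + j - 1) (b + b') c 1

/-- The product `(e)_j · ₃F₂(-j, a, s; e, c; 1)` with the factors `(e)_j / (e)_k`, `k ≤ j`,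
cancelled to `(e + k)_{j - k}`; it is a polynomial in `e`. -/
def clearedHyp₃F₂ (j : ℕ) (a s e c : ℂ) : ℂ :=
  ∑ k ∈ Finset.range (j + 1),
    poch (-(j : ℂ)) k * poch a k * poch s k * poch (e + k) (j - k) / (poch c k * (k ! : ℂ))

/-- The coefficient `C_j` with the zeros of `(a + a')_j` and `(b + b')_j` cancelled against the
poles of the two `₃F₂(1)`, so that `a + a'` and `b + b'` may be arbitrary. -/
def multCoeff (a b c a' b' c' : ℂ) (j : ℕ) : ℂ :=
  poch c j / ((j ! : ℂ) * (poch c' j * poch (c + c' + j - 1) j)) *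
    clearedHyp₃F₂ j a (c + c' + j - 1) (a + a') c *
    clearedHyp₃F₂ j b (c + c' + j - 1) (b + b') c

/-- `(e)_j ≠ 0`: the number `e` is none of `0, -1, …, -(j - 1)`. -/
def NoZeroBelow (e : ℂ) (j : ℕ) : Prop := ∀ m : ℕ, m < j → e ≠ -(m : ℂ)

end

/-! The coefficient identity comes from a Fischer-type decomposition. On homogeneous polynomials in
`x, y` let `D = x∂ₓ² + c∂ₓ + y∂ᵧ² + c'∂ᵧ`. Its kernel in degree `n` is spanned by a Jacobi
polynomial `P_n`, and its commutator with `x + y` is the scalar `c + c' + 2n`. Hence the degree `n`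
part of `₀F₁(c; xu) ₀F₁(c'; yv)` is diagonal in the products `(x + y)^(n-j) P_j`
(`diagWeight_expansion`). The functional `x^k y^(n-k) ↦ (a)_k (a')_(n-k)` turns multiplication by `x
+ y` into a scalar. Applied in `x, y`, and with `b, b'` in `u, v`, it gives the identity between
coefficients of `z^n` (`sum_coeff_mul_coeff`). Applied to Pfaff's form of `P_j`, it identifies its
value at `P_j` with the cleared `₃F₂` (`clearedHyp_eq_altConv`).

Analytically, the double series must be summable, so that summing by rows and by antidiagonals
agree. Its coefficients grow polynomially: the values at `P_j` are bounded through beta integrals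
and contiguous relations (`polyBounded_altConv_pochRatio`), the other factors by comparing
factorials. The limit statement is continuity of the cleared form. -/

section Pochhammer

@[simp]
lemma poch_zero (x : ℂ) : poch x 0 = 1 := by simp [poch]

lemma poch_succ (x : ℂ) (n : ℕ) : poch x (n + 1) = poch x n * (x + n) :=
  ascPochhammer_succ_eval n x

lemma poch_succ_left (x : ℂ) (n : ℕ) : poch x (n + 1) = x * poch (x + 1) n := by
  simp [poch, ascPochhammer_succ_left, Polynomial.eval_comp]

lemma poch_add (x : ℂ) (n m : ℕ) : poch x (n + m) = poch x n * poch (x + n) m := by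
  induction m with
  | zero => simp
  | succ m ih => rw [← add_assoc, poch_succ, poch_succ, ih]; push_cast; ring

lemma poch_ne_zero {x : ℂ} (n : ℕ) (hx : ∀ m < n, x ≠ -(m : ℂ)) : poch x n ≠ 0 := by
  induction n with
  | zero => simp
  | succ n ih =>
    rw [poch_succ]
    exact mul_ne_zero (ih fun m hm => hx m (by omega)) fun h =>
      hx n (by omega) (eq_neg_of_add_eq_zero_left h)

lemma poch_neg_natCast_eq_zero {j k : ℕ} (h : j < k) : poch (-(j : ℂ)) k = 0 := by
  obtain ⟨m, rfl⟩ := Nat.exists_eq_add_of_lt h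
  rw [add_assoc, add_comm m 1, ← add_assoc, poch_add, poch_succ]
  simp

lemma poch_neg_natCast_self (n : ℕ) : poch (-(n : ℂ)) n = (-1) ^ n * (n ! : ℂ) := by
  induction n with
  | zero => simp
  | succ n ih =>
    rw [poch_succ_left]
    have : -((n + 1 : ℕ) : ℂ) + 1 = -(n : ℂ) := by push_cast; ring
    rw [this, ih, Nat.factorial_succ]; push_cast; ring

lemma add_natCast_ne_zero {x : ℂ} (hx : ∀ n : ℕ, x ≠ -(n : ℂ)) (n : ℕ) : x + n ≠ 0 :=
  fun h => hx n (eq_neg_of_add_eq_zero_left h)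

lemma add_natCast_ne_neg {x : ℂ} (hx : ∀ n : ℕ, x ≠ -(n : ℂ)) (m n : ℕ) :
    x + m ≠ -(n : ℂ) := fun h => hx (m + n) (by
  push_cast; linear_combination h)

end Pochhammer

open Polynomial in
/-- The operator on polynomials in `X = x / y` induced by
`x ∂ₓ² + c ∂ₓ + y ∂ᵧ² + c' ∂ᵧ` on homogeneous polynomials of degree `n` in `x, y`. -/
noncomputable def jacobiOp (c c' : ℂ) (n : ℕ) : ℂ[X] →ₗ[ℂ] ℂ[X] :=
  LinearMap.mulLeft ℂ (X * (1 + X)) ∘ₗ derivative ∘ₗ derivative +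
    LinearMap.mulLeft ℂ (C c + C (2 - 2 * n - c') * X) ∘ₗ derivative +
    LinearMap.mulLeft ℂ (C (n * (n + c' - 1)))

open Polynomial in
/-- The homogeneous Jacobi polynomial of degree `n`, dehomogenized. -/
noncomputable def jacobiPoly (c c' : ℂ) (n : ℕ) : ℂ[X] :=
  ∑ i ∈ Finset.range (n + 1),
    C ((-1) ^ i * (n.choose i : ℂ) / (poch c i * poch c' (n - i))) * X ^ i

open Polynomial in
/-- The linear functional `X ^ k ↦ (a)_k (a')_{n - k}`, `k ≤ n`. -/
noncomputable def pochFunctional (a a' : ℂ) (n : ℕ) : ℂ[X] →ₗ[ℂ] ℂ where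
  toFun p := ∑ k ∈ Finset.range (n + 1), p.coeff k * (poch a k * poch a' (n - k))
  map_add' p q := by simp [add_mul, Finset.sum_add_distrib]
  map_smul' r p := by simp [Finset.mul_sum, mul_assoc]

/-- The binomial convolution of `u` and `v` with alternating signs. -/
noncomputable def altConv (u v : ℕ → ℂ) (j : ℕ) : ℂ :=
  ∑ k ∈ Finset.range (j + 1), (-1) ^ k * (j.choose k : ℂ) * u k * v (j - k)

/-- The quotient `(a)_k / (c)_k`. -/
noncomputable def pochRatio (a c : ℂ) (k : ℕ) : ℂ := poch a k / poch c k

/-! ### Jacobi polynomials as the kernel of the operator; Pfaff's transformation -/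

section Jacobi

open Polynomial

variable {c c' : ℂ}

lemma jacobiOp_apply (c c' : ℂ) (n : ℕ) (p : ℂ[X]) :
    jacobiOp c c' n p = X * (1 + X) * derivative (derivative p) +
      (C c + C (2 - 2 * n - c') * X) * derivative p + C (n * (n + c' - 1)) * p := rfl

lemma coeff_jacobiOp (c c' : ℂ) (n : ℕ) (p : ℂ[X]) (k : ℕ) :
    (jacobiOp c c' n p).coeff k =
      (k + 1) * (c + k) * p.coeff (k + 1) + (n - k) * (c' + n - 1 - k) * p.coeff k := by
  rw [jacobiOp_apply, mul_assoc X, add_mul 1 X, one_mul, add_mul (C c), mul_assoc (C _) X]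
  rcases k with _ | _ | k
  · simp only [coeff_add, coeff_X_mul_zero, coeff_C_mul, coeff_derivative]
    push_cast; ring
  · simp only [coeff_add, coeff_X_mul, coeff_C_mul, coeff_derivative, coeff_X_mul_zero]
    push_cast; ring_nf
  · simp only [coeff_add, coeff_X_mul, coeff_C_mul, coeff_derivative]
    push_cast; ring

/-- The commutator of the operator with `x + y`. The operator lowers the degree by one, hence `n +
1` on the left and `n` on the right. -/
lemma jacobiOp_one_add_X_mul (c c' : ℂ) (n : ℕ) (q : ℂ[X]) :
    jacobiOp c c' (n + 1) ((1 + X) * q) =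
      (1 + X) * jacobiOp c c' n q + C (c + c' + 2 * n) * q := by
  simp only [jacobiOp_apply, derivative_mul, derivative_add, derivative_one, derivative_X,
    C_add, C_sub, C_mul, Nat.cast_add, Nat.cast_one, C_1, map_ofNat, derivative_zero]
  ring

/-- The scalar is the sum of `c + c' + 2(n + i)` over `i < m`. At `m = 0` it vanishes, so the
truncated exponent is harmless. -/
lemma jacobiOp_one_add_X_pow_mul (c c' : ℂ) (n m : ℕ) (q : ℂ[X]) :
    jacobiOp c c' (n + m) ((1 + X) ^ m * q) =
      (1 + X) ^ m * jacobiOp c c' n q +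
        C (m * (c + c' + 2 * n + m - 1)) * ((1 + X) ^ (m - 1) * q) := by
  induction m with
  | zero => simp
  | succ m ih =>
    rw [pow_succ', mul_assoc, ← add_assoc, jacobiOp_one_add_X_mul, ih]
    rcases m with _ | m
    · simp
    · simp only [Nat.add_sub_cancel, pow_succ, C_add, C_sub, C_mul, Nat.cast_add, Nat.cast_one,
        C_1, map_ofNat]
      ring

lemma jacobiOp_X_pow (c c' : ℂ) (n k : ℕ) :
    jacobiOp c c' n (X ^ k) = C (k * (c + k - 1)) * X ^ (k - 1) +
      C ((n - k) * (c' + n - 1 - k)) * X ^ k := by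
  ext i
  simp only [coeff_jacobiOp, coeff_X_pow, coeff_add, coeff_C_mul]
  rcases k with _ | k
  · rcases i with _ | i <;> simp
  · by_cases h : i = k
    · subst h; simp [← add_assoc]
    · by_cases h' : i = k + 1
      · subst h'; simp
      · simp [h, h']

/-- The kernel equation is a two-term recursion whose leading factor `(k + 1)(c + k)` never
vanishes, so the constant term determines everything. All uniqueness arguments below rest on this.
-/
lemma eq_zero_of_jacobiOp_eq_zero (hc : ∀ n : ℕ, c ≠ -(n : ℂ)) {n : ℕ} {p : ℂ[X]}
    (hp : jacobiOp c c' n p = 0) (h0 : p.coeff 0 = 0) : p = 0 := by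
  ext k
  induction k with
  | zero => simpa using h0
  | succ k ih =>
    have h := coeff_jacobiOp c c' n p k
    rw [hp, ih] at h
    simp only [coeff_zero, mul_zero, add_zero] at h ⊢
    have h1 : (k + 1 : ℂ) ≠ 0 := by exact_mod_cast k.succ_ne_zero
    simpa [h1, add_natCast_ne_zero hc k] using h.symm

lemma coeff_jacobiPoly (c c' : ℂ) (n i : ℕ) : (jacobiPoly c c' n).coeff i =
    (-1) ^ i * (n.choose i : ℂ) / (poch c i * poch c' (n - i)) := by
  simp only [jacobiPoly, finsetSum_coeff, coeff_C_mul, coeff_X_pow, mul_ite, mul_one, mul_zero,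
    Finset.sum_ite_eq, Finset.mem_range]
  split_ifs with h
  · rfl
  · rw [Nat.choose_eq_zero_of_lt (by omega)]; simp

lemma natDegree_jacobiPoly_le (c c' : ℂ) (n : ℕ) : (jacobiPoly c c' n).natDegree ≤ n := by
  rw [natDegree_le_iff_coeff_eq_zero]
  intro i hi
  rw [coeff_jacobiPoly, Nat.choose_eq_zero_of_lt hi]; simp

lemma jacobiOp_jacobiPoly (hc : ∀ n : ℕ, c ≠ -(n : ℂ)) (hc' : ∀ n : ℕ, c' ≠ -(n : ℂ)) (n : ℕ) :
    jacobiOp c c' n (jacobiPoly c c' n) = 0 := by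
  ext k
  rw [coeff_jacobiOp, coeff_jacobiPoly, coeff_jacobiPoly, coeff_zero]
  rcases lt_trichotomy k n with h | rfl | h
  · obtain ⟨m, rfl⟩ := Nat.exists_eq_add_of_lt h
    have h1 : k + m + 1 - (k + 1) = m := by omega
    have h2 : k + m + 1 - k = m + 1 := by omega
    have h3 : ((k + m + 1).choose (k + 1) : ℂ) * (k + 1) = (k + m + 1).choose k * (m + 1) := by
      have := Nat.choose_succ_right_eq (k + m + 1) k
      rw [h2] at this
      exact_mod_cast this
    rw [h1, h2, poch_succ, poch_succ]
    have := poch_ne_zero k fun m _ => hc m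
    have := poch_ne_zero m fun m _ => hc' m
    have := add_natCast_ne_zero hc k
    have := add_natCast_ne_zero hc' m
    push_cast
    field_simp
    linear_combination (-1) ^ (k + 1) * (c' + m) * h3
  · simp
  · rw [Nat.choose_eq_zero_of_lt h, Nat.choose_eq_zero_of_lt (by omega)]; simp

/-- Pfaff's transformation for the terminating series that define the Jacobi polynomials. -/
lemma sum_X_pow_mul_one_add_X_pow (hc : ∀ n : ℕ, c ≠ -(n : ℂ)) (hc' : ∀ n : ℕ, c' ≠ -(n : ℂ))
    (j : ℕ) :
    ∑ k ∈ Finset.range (j + 1), C (poch (-(j : ℂ)) k * poch (c + c' + j - 1) k /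
        (poch c k * (k ! : ℂ))) * ((1 + X) ^ (j - k) * X ^ k) =
      C (poch c' j) * jacobiPoly c c' j := by
  set t : ℕ → ℂ := fun k => poch (-(j : ℂ)) k * poch (c + c' + j - 1) k /
        (poch c k * (k ! : ℂ)) with ht
  rw [← sub_eq_zero]
  apply eq_zero_of_jacobiOp_eq_zero hc (c' := c') (n := j)
  · rw [map_sub, ← smul_eq_C_mul, map_smul, jacobiOp_jacobiPoly hc hc', smul_zero, sub_zero,
      map_sum]
    -- The ratio `t (k + 1) / t k` makes the commutator term of index `k` cancel the `X`-derivative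
    -- term of index `k + 1`, so the images telescope. The end terms vanish through the factor `k`
    -- at `0` and `(-j)_(j+1) = 0`.
    have key : ∀ k ∈ Finset.range (j + 1), jacobiOp c c' j (C (t k) * ((1 + X) ^ (j - k) * X ^ k))
        = C (t k * (k * (c + k - 1))) * ((1 + X) ^ (j - k) * X ^ (k - 1)) -
          C (t (k + 1) * ((k + 1 : ℕ) * (c + (k + 1 : ℕ) - 1))) *
            ((1 + X) ^ (j - (k + 1)) * X ^ (k + 1 - 1)) := by
      intro k hk
      obtain ⟨m, rfl⟩ := Nat.exists_eq_add_of_le (Nat.lt_succ_iff.mp (Finset.mem_range.mp hk))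
      rw [← smul_eq_C_mul, map_smul, Nat.add_sub_cancel_left, jacobiOp_one_add_X_pow_mul,
        jacobiOp_X_pow, smul_eq_C_mul]
      have h1 : k + m - (k + 1) = m - 1 := by omega
      have h2 : t (k + 1) * ((k + 1 : ℕ) * (c + (k + 1 : ℕ) - 1)) =
          - (t k * (m * (c + c' + 2 * k + m - 1))) := by
        simp only [ht]
        rw [poch_succ, poch_succ, poch_succ, Nat.factorial_succ]
        have := poch_ne_zero k fun m _ => hc m
        have := add_natCast_ne_zero hc k
        have : (k ! : ℂ) ≠ 0 := by exact_mod_cast k.factorial_ne_zero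
        have : (k + 1 : ℂ) ≠ 0 := by exact_mod_cast k.succ_ne_zero
        push_cast
        have h3 : c + (k + 1) - 1 = c + k := by ring
        rw [h3]
        field_simp
        ring
      rw [h1, h2, Nat.add_sub_cancel]
      simp only [sub_self, zero_mul, C_0, add_zero, C_mul, C_neg]
      ring
    rw [Finset.sum_congr rfl key, Finset.sum_range_sub'
      (fun k => C (t k * (k * (c + k - 1))) * ((1 + X) ^ (j - k) * X ^ (k - 1)))]
    simp [ht, poch_neg_natCast_eq_zero (Nat.lt_succ_self j)]
  -- Both constant terms are `1`: only `k = 0` contributes on the left.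
  · rw [coeff_sub, coeff_C_mul, coeff_jacobiPoly, finsetSum_coeff, Finset.sum_range_succ',
      Finset.sum_eq_zero]
    · simp [coeff_zero_eq_eval_zero, poch_ne_zero j fun m _ => hc' m]
    · intro k _
      simp [coeff_zero_eq_eval_zero]

/-- At `X = -1` only the term `k = n` of Pfaff's form survives. -/
lemma eval_jacobiPoly_neg_one (hc : ∀ n : ℕ, c ≠ -(n : ℂ)) (hc' : ∀ n : ℕ, c' ≠ -(n : ℂ))
    (n : ℕ) : (jacobiPoly c c' n).eval (-1) =
      poch (c + c' + n - 1) n / (poch c n * poch c' n) := by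
  have h := congrArg (eval (-1)) (sum_X_pow_mul_one_add_X_pow hc hc' n)
  rw [eval_finsetSum, Finset.sum_range_succ, Finset.sum_eq_zero] at h
  · simp only [eval_mul, eval_C, eval_pow, eval_one, eval_X, Nat.sub_self, pow_zero,
      poch_neg_natCast_self] at h
    have h1 := poch_ne_zero n fun m _ => hc m
    have h2 := poch_ne_zero n fun m _ => hc' m
    have : (n ! : ℂ) ≠ 0 := by exact_mod_cast n.factorial_ne_zero
    have h3 : ((-1 : ℂ) ^ n) * (-1) ^ n = 1 := by rw [← mul_pow]; simp
    rw [eq_div_iff (mul_ne_zero h1 h2)]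
    field_simp at h
    linear_combination (-1 : ℂ) * h + poch (c + c' + n - 1) n * h3
  · intro k hk
    have : n - k ≠ 0 := by have := Finset.mem_range.mp hk; omega
    simp [this]

end Jacobi

/-! ### The Pochhammer functional -/

section Functional

open Polynomial

lemma pochFunctional_apply (a a' : ℂ) (n : ℕ) (p : ℂ[X]) : pochFunctional a a' n p =
    ∑ k ∈ Finset.range (n + 1), p.coeff k * (poch a k * poch a' (n - k)) := rfl

lemma pochFunctional_X_pow (a a' : ℂ) {n k : ℕ} (h : k ≤ n) :
    pochFunctional a a' n (X ^ k) = poch a k * poch a' (n - k) := by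
  simp only [pochFunctional_apply, coeff_X_pow, ite_mul, one_mul, zero_mul, Finset.sum_ite_eq',
    Finset.mem_range]
  rw [if_pos (by omega)]

/-- On a monomial the two contributions carry the factors `a + k` and `a' + n - k`, whose sum does
not depend on `k`. -/
lemma pochFunctional_one_add_X_mul (a a' : ℂ) {n : ℕ} {q : ℂ[X]} (hq : q.natDegree ≤ n) :
    pochFunctional a a' (n + 1) ((1 + X) * q) = (a + a' + n) * pochFunctional a a' n q := by
  have h0 : q.coeff (n + 1) = 0 := coeff_eq_zero_of_natDegree_lt (by omega)
  simp only [pochFunctional_apply, add_mul, one_mul, coeff_add, Finset.sum_add_distrib]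
  rw [Finset.sum_range_succ, h0,
    Finset.sum_range_succ' _ (n + 1)]
  simp only [coeff_X_mul, coeff_X_mul_zero, zero_mul, add_zero]
  rw [← Finset.sum_add_distrib, ← add_mul, ← add_mul, Finset.mul_sum]
  refine Finset.sum_congr rfl fun k hk => ?_
  obtain ⟨m, rfl⟩ := Nat.exists_eq_add_of_le (Nat.lt_succ_iff.mp (Finset.mem_range.mp hk))
  have h1 : k + m + 1 - k = m + 1 := by omega
  have h2 : k + m + 1 - (k + 1) = m := by omega
  rw [h1, h2, Nat.add_sub_cancel_left, poch_succ, poch_succ]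
  push_cast; ring

lemma pochFunctional_one_add_X_pow_mul (a a' : ℂ) {n : ℕ} (m : ℕ) {q : ℂ[X]}
    (hq : q.natDegree ≤ n) : pochFunctional a a' (n + m) ((1 + X) ^ m * q) =
      poch (a + a' + n) m * pochFunctional a a' n q := by
  induction m with
  | zero => simp
  | succ m ih =>
    have h : ((1 + X) ^ m * q : ℂ[X]).natDegree ≤ n + m := by
      refine natDegree_mul_le.trans ?_
      have : ((1 + X : ℂ[X]) ^ m).natDegree ≤ m * 1 :=
        natDegree_pow_le_of_le m (by rw [add_comm]; exact (natDegree_X_add_C (1 : ℂ)).le)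
      omega
    rw [pow_succ', mul_assoc, ← add_assoc, pochFunctional_one_add_X_mul _ _ h, ih, poch_succ]
    push_cast; ring

lemma pochFunctional_jacobiPoly (a a' c c' : ℂ) (n : ℕ) :
    pochFunctional a a' n (jacobiPoly c c' n) =
      altConv (pochRatio a c) (pochRatio a' c') n := by
  rw [pochFunctional_apply, altConv]
  refine Finset.sum_congr rfl fun k _ => ?_
  rw [coeff_jacobiPoly, pochRatio, pochRatio]
  simp only [div_eq_mul_inv, mul_inv]
  ring

/-- The functional applied to Pfaff's transformation: `(1 + X)^(j-k) X^k` goes to `(a)_k (a + a' +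
k)_(j-k)`, without division, so `a + a'` is arbitrary. -/
lemma clearedHyp_eq_altConv {c c' : ℂ} (hc : ∀ n : ℕ, c ≠ -(n : ℂ)) (hc' : ∀ n : ℕ, c' ≠ -(n : ℂ))
    (a a' : ℂ) (j : ℕ) : clearedHyp₃F₂ j a (c + c' + j - 1) (a + a') c =
      poch c' j * altConv (pochRatio a c) (pochRatio a' c') j := by
  have h := congrArg (pochFunctional a a' j) (sum_X_pow_mul_one_add_X_pow hc hc' j)
  rw [← smul_eq_C_mul, map_smul, pochFunctional_jacobiPoly, smul_eq_mul] at h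
  rw [← h, map_sum, clearedHyp₃F₂]
  refine Finset.sum_congr rfl fun k hk => ?_
  obtain ⟨m, rfl⟩ := Nat.exists_eq_add_of_le (Nat.lt_succ_iff.mp (Finset.mem_range.mp hk))
  rw [← smul_eq_C_mul, map_smul, Nat.add_sub_cancel_left,
    pochFunctional_one_add_X_pow_mul _ _ _ (natDegree_X_pow_le k), pochFunctional_X_pow _ _ le_rfl,
    smul_eq_mul]
  simp only [Nat.sub_self, poch_zero]
  ring

end Functional

/-- The coefficient of `S_j(a) S_j(b) (a + a' + j)_m (b + b' + j)_m` in the coefficient of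
`z ^ (j + m)` of the product of two `₂F₁`. -/
noncomputable def expansionCoeff (c c' : ℂ) (j m : ℕ) : ℂ :=
  poch c j * poch c' j /
    ((j ! : ℂ) * poch (c + c' + j - 1) j * poch (c + c' + 2 * j) m * (m ! : ℂ))

/-! ### Bateman-type expansion and the coefficient identity -/

section Expansion

open Polynomial

variable {c c' : ℂ}

lemma poch_add_sub_one_ne_zero {g : ℂ} (hg : ∀ n : ℕ, g ≠ -(n : ℂ)) (j : ℕ) :
    poch (g + j - 1) j ≠ 0 := by
  rcases j with _ | j
  · simp
  · refine poch_ne_zero _ fun m _ h => hg (j + m) ?_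
    push_cast at h ⊢
    linear_combination h

lemma poch_add_two_mul_ne_zero {g : ℂ} (hg : ∀ n : ℕ, g ≠ -(n : ℂ)) (j m : ℕ) :
    poch (g + 2 * j) m ≠ 0 :=
  poch_ne_zero m fun i _ => by exact_mod_cast add_natCast_ne_neg hg (2 * j) i

/-- The factor is the scalar of `jacobiOp_one_add_X_pow_mul` for `(1 + X)^(m+1) P_j`, so the
operator carries the expansion in one degree to that in the degree below. -/
lemma expansionCoeff_succ (hg : ∀ n : ℕ, c + c' ≠ -(n : ℂ)) (j m : ℕ) :
    expansionCoeff c c' j (m + 1) * ((m + 1 : ℕ) * (c + c' + 2 * j + (m + 1 : ℕ) - 1)) =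
      expansionCoeff c c' j m := by
  have h1 := poch_add_sub_one_ne_zero hg j
  have h2 := poch_add_two_mul_ne_zero hg j m
  have h3 : c + c' + 2 * j + m ≠ 0 := by
    have := add_natCast_ne_zero hg (2 * j + m)
    push_cast at this
    rwa [← add_assoc] at this
  have h4 : (m ! : ℂ) ≠ 0 := by exact_mod_cast m.factorial_ne_zero
  have h5 : (j ! : ℂ) ≠ 0 := by exact_mod_cast j.factorial_ne_zero
  have h6 : (m + 1 : ℂ) ≠ 0 := by exact_mod_cast m.succ_ne_zero
  have h7 : c + c' + 2 * j + (m + 1 : ℕ) - 1 = c + c' + 2 * j + m := by push_cast; ring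
  rw [expansionCoeff, expansionCoeff, poch_succ, Nat.factorial_succ, h7]
  generalize c + c' + 2 * (j : ℂ) = G at *
  push_cast
  field_simp

/-- The coefficients of the generating polynomial of a product of two `₀F₁`. -/
noncomputable def diagWeight (c c' : ℂ) (n l : ℕ) : ℂ :=
  (n.choose l : ℂ) / ((n ! : ℂ) * (poch c l * poch c' (n - l)))

/-- On the kernel `∑ₗ diagWeight n l · Xˡ Uˡ` the operator in `X` acts as multiplication by `1 + U`.
This is the coefficient of `U⁰`; the next lemma gives the others. -/
lemma jacobiOp_diagWeight_zero (hc' : ∀ n : ℕ, c' ≠ -(n : ℂ)) (n : ℕ) :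
    jacobiOp c c' (n + 1) (C (diagWeight c c' (n + 1) 0) * X ^ 0) =
      C (diagWeight c c' n 0) * X ^ 0 := by
  rw [← smul_eq_C_mul, map_smul, jacobiOp_X_pow, smul_eq_C_mul]
  have h1 := poch_ne_zero n fun m _ => hc' m
  have h2 := add_natCast_ne_zero hc' n
  have h3 : (n ! : ℂ) ≠ 0 := by exact_mod_cast n.factorial_ne_zero
  have h6 : (n + 1 : ℂ) ≠ 0 := by exact_mod_cast n.succ_ne_zero
  have : diagWeight c c' (n + 1) 0 * ((n + 1 : ℕ) * (c' + n)) = diagWeight c c' n 0 := by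
    simp only [diagWeight, Nat.sub_zero, Nat.choose_zero_right, poch_succ, poch_zero,
      Nat.factorial_succ]
    push_cast
    field_simp
  rw [← this]
  simp only [C_mul, C_add, C_sub, Nat.cast_add, Nat.cast_zero, Nat.cast_one, C_0, C_1]
  ring

lemma jacobiOp_diagWeight_succ (hc : ∀ n : ℕ, c ≠ -(n : ℂ)) (hc' : ∀ n : ℕ, c' ≠ -(n : ℂ))
    (n l : ℕ) :
    jacobiOp c c' (n + 1) (C (diagWeight c c' (n + 1) (l + 1)) * X ^ (l + 1)) =
      C (diagWeight c c' n (l + 1)) * X ^ (l + 1) + C (diagWeight c c' n l) * X ^ l := by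
  rw [← smul_eq_C_mul, map_smul, jacobiOp_X_pow, smul_eq_C_mul]
  have h1 := poch_ne_zero l fun m _ => hc m
  have h2 := add_natCast_ne_zero hc l
  have h3 : (n ! : ℂ) ≠ 0 := by exact_mod_cast n.factorial_ne_zero
  have h6 : (n + 1 : ℂ) ≠ 0 := by exact_mod_cast n.succ_ne_zero
  have e1 : diagWeight c c' (n + 1) (l + 1) * ((l + 1 : ℕ) * (c + l)) = diagWeight c c' n l := by
    have h := Nat.add_one_mul_choose_eq n l
    have h' : ((n + 1 : ℂ)) * n.choose l = (n + 1).choose (l + 1) * (l + 1) := by exact_mod_cast h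
    simp only [diagWeight, Nat.add_sub_add_right, poch_succ, Nat.factorial_succ]
    have := poch_ne_zero (n - l) fun m _ => hc' m
    push_cast
    field_simp
    linear_combination -h'
  have e2 : diagWeight c c' (n + 1) (l + 1) * (((n : ℂ) - l) * (c' + n - l - 1)) =
      diagWeight c c' n (l + 1) := by
    rcases lt_trichotomy l n with h | rfl | h
    · obtain ⟨m, rfl⟩ := Nat.exists_eq_add_of_lt h
      have i1 : l + m + 1 + 1 - (l + 1) = m + 1 := by omega
      have i2 : l + m + 1 - (l + 1) = m := by omega
      have h' : ((l + m + 1 + 1).choose (l + 1) : ℂ) * (m + 1) =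
          (l + m + 1 + 1) * (l + m + 1).choose (l + 1) := by
        have := Nat.choose_mul_succ_eq (l + m + 1) (l + 1)
        rw [i1] at this
        rw [mul_comm (l + m + 1 + 1 : ℂ)]
        exact_mod_cast this.symm
      simp only [diagWeight, i1, i2, poch_succ, Nat.factorial_succ]
      have := poch_ne_zero m fun m _ => hc' m
      have := add_natCast_ne_zero hc' m
      have : ((l + m)! : ℂ) ≠ 0 := by exact_mod_cast (l + m).factorial_ne_zero
      have : (l + m + 1 : ℂ) ≠ 0 := by exact_mod_cast (l + m).succ_ne_zero
      have : (l + m + 1 + 1 : ℂ) ≠ 0 := by exact_mod_cast (l + m + 1).succ_ne_zero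
      push_cast
      have i3 : c' + (l + m + 1) - l - 1 = c' + m := by ring
      rw [i3]
      field_simp
      linear_combination h'
    · simp [diagWeight]
    · simp [diagWeight, Nat.choose_eq_zero_of_lt (show n < l + 1 by omega),
        Nat.choose_eq_zero_of_lt (show n + 1 < l + 1 by omega)]
  rw [← e1, ← e2, Nat.add_sub_cancel]
  simp only [C_mul, C_add, C_sub, Nat.cast_add, Nat.cast_one, C_1]
  ring

/-- Expansion of a monomial in terms of the polynomials `(1 + X) ^ (n - j) * P_j`, where `P_j` are
the Jacobi polynomials; this is the coefficient form of Bateman's expansion of a product of two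
Bessel functions. -/
theorem diagWeight_expansion (hc : ∀ n : ℕ, c ≠ -(n : ℂ)) (hc' : ∀ n : ℕ, c' ≠ -(n : ℂ))
    (hg : ∀ n : ℕ, c + c' ≠ -(n : ℂ)) (n l : ℕ) :
    C (diagWeight c c' n l) * X ^ l = ∑ j ∈ Finset.range (n + 1),
      C (expansionCoeff c c' j (n - j) * ((1 + X) ^ (n - j) * jacobiPoly c c' j).coeff l) *
        ((1 + X) ^ (n - j) * jacobiPoly c c' j) := by
  induction n generalizing l with
  | zero =>
    rcases l with _ | l
    · simp [diagWeight, expansionCoeff, jacobiPoly]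
    · simp [diagWeight, jacobiPoly]
  | succ n ih =>
    set E : ℂ[X] := C (diagWeight c c' (n + 1) l) * X ^ l - ∑ j ∈ Finset.range (n + 1 + 1),
      C (expansionCoeff c c' j (n + 1 - j) *
        ((1 + X) ^ (n + 1 - j) * jacobiPoly c c' j).coeff l) *
        ((1 + X) ^ (n + 1 - j) * jacobiPoly c c' j) with hE
    rw [← sub_eq_zero, ← hE]
    -- The operator sends the error in degree `n + 1` to a sum of errors in degree `n`, zero by
    -- induction; the term `j = n + 1` is annihilated.
    have hD : jacobiOp c c' (n + 1) E = 0 := by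
      have step : ∀ j ∈ Finset.range (n + 1), jacobiOp c c' (n + 1)
          (C (expansionCoeff c c' j (n + 1 - j) *
            ((1 + X) ^ (n + 1 - j) * jacobiPoly c c' j).coeff l) *
            ((1 + X) ^ (n + 1 - j) * jacobiPoly c c' j)) =
          C (expansionCoeff c c' j (n - j) *
            ((1 + X) * ((1 + X) ^ (n - j) * jacobiPoly c c' j)).coeff l) *
            ((1 + X) ^ (n - j) * jacobiPoly c c' j) := by
        intro j hj
        obtain ⟨m, rfl⟩ := Nat.exists_eq_add_of_le (Nat.lt_succ_iff.mp (Finset.mem_range.mp hj))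
        have i1 : j + m + 1 - j = m + 1 := by omega
        rw [← smul_eq_C_mul, map_smul, i1, Nat.add_sub_cancel_left, add_assoc j m 1,
          jacobiOp_one_add_X_pow_mul, jacobiOp_jacobiPoly hc hc', mul_zero, zero_add,
          smul_eq_C_mul, ← mul_assoc, ← C_mul, Nat.add_sub_cancel, ← expansionCoeff_succ hg j m,
          pow_succ', mul_assoc (1 + X)]
        congr 2
        ring
      have last : ∀ r : ℂ, jacobiOp c c' (n + 1)
          (C r * ((1 + X) ^ (n + 1 - (n + 1)) * jacobiPoly c c' (n + 1))) = 0 := fun r => by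
        rw [← smul_eq_C_mul, map_smul, Nat.sub_self, pow_zero, one_mul,
          jacobiOp_jacobiPoly hc hc', smul_zero]
      rw [hE, map_sub, map_sum, Finset.sum_range_succ, Finset.sum_congr rfl step, last, add_zero]
      rcases l with _ | l
      · rw [jacobiOp_diagWeight_zero hc', ih, sub_eq_zero]
        refine Finset.sum_congr rfl fun j _ => ?_
        rw [add_mul, coeff_add, one_mul, coeff_X_mul_zero, add_zero]
      · rw [jacobiOp_diagWeight_succ hc hc', ih, ih, sub_eq_zero, ← Finset.sum_add_distrib]
        refine Finset.sum_congr rfl fun j _ => ?_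
        rw [add_mul 1 X, coeff_add, one_mul, coeff_X_mul, mul_add, C_add, add_mul]
    set P := jacobiPoly c c' (n + 1) with hP
    have hP0 : P.coeff 0 ≠ 0 := by
      rw [hP, coeff_jacobiPoly]
      simpa using poch_ne_zero (n + 1) fun m _ => hc' m
    have hg' := poch_add_sub_one_ne_zero hg (n + 1)
    have h1 := poch_ne_zero (n + 1) fun m _ => hc m
    have h2 := poch_ne_zero (n + 1) fun m _ => hc' m
    have hPe : P.eval (-1) ≠ 0 := by
      rw [hP, eval_jacobiPoly_neg_one hc hc']
      exact div_ne_zero hg' (mul_ne_zero h1 h2)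
    have hEP : E = C (E.coeff 0 / P.coeff 0) * P := by
      rw [← sub_eq_zero]
      refine eq_zero_of_jacobiOp_eq_zero hc (c' := c') (n := n + 1) ?_ ?_
      · rw [map_sub, hD, ← smul_eq_C_mul, map_smul, hP, jacobiOp_jacobiPoly hc hc']; simp
      · rw [coeff_sub, coeff_C_mul, div_mul_cancel₀ _ hP0, sub_self]
    -- At `-1` all terms with `j ≤ n` vanish, and the normalization of `expansionCoeff` makes the
    -- last one match the monomial. As `P (-1) ≠ 0`, the multiple of `P` left over is zero.
    have hEe : E.eval (-1) = 0 := by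
      rw [hE, eval_sub, eval_finsetSum, Finset.sum_range_succ, Finset.sum_eq_zero, zero_add]
      · simp only [Nat.sub_self, pow_zero, one_mul, eval_mul, eval_C, eval_pow, eval_X,
          eval_jacobiPoly_neg_one hc hc', coeff_jacobiPoly, diagWeight, expansionCoeff, poch_zero,
          Nat.factorial_zero, Nat.cast_one, mul_one]
        have : ((n + 1)! : ℂ) ≠ 0 := by exact_mod_cast (n + 1).factorial_ne_zero
        have := poch_ne_zero l fun m _ => hc m
        have := poch_ne_zero (n + 1 - l) fun m _ => hc' m
        field_simp
        ring
      · intro j hj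
        have : n + 1 - j ≠ 0 := by have := Finset.mem_range.mp hj; omega
        simp [this]
    have hμ : E.coeff 0 / P.coeff 0 = 0 := by
      rw [hEP, eval_mul, eval_C] at hEe
      exact (mul_eq_zero.mp hEe).resolve_right hPe
    rw [hEP, hμ, C_0, zero_mul]

lemma pochFunctional_expansion_term (a a' : ℂ) {n j : ℕ} (h : j ≤ n) :
    pochFunctional a a' n ((1 + X) ^ (n - j) * jacobiPoly c c' j) =
      poch (a + a' + j) (n - j) * altConv (pochRatio a c) (pochRatio a' c') j := by
  obtain ⟨m, rfl⟩ := Nat.exists_eq_add_of_le h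
  rw [Nat.add_sub_cancel_left, pochFunctional_one_add_X_pow_mul _ _ _
    (natDegree_jacobiPoly_le c c' j), pochFunctional_jacobiPoly]

/-- The identity between the coefficients of `z ^ n` in the multiplication formula. -/
theorem sum_coeff_mul_coeff (hc : ∀ n : ℕ, c ≠ -(n : ℂ)) (hc' : ∀ n : ℕ, c' ≠ -(n : ℂ))
    (hg : ∀ n : ℕ, c + c' ≠ -(n : ℂ)) (a a' b b' : ℂ) (n : ℕ) :
    ∑ l ∈ Finset.range (n + 1), poch a l * poch b l / (poch c l * (l ! : ℂ)) *
        (poch a' (n - l) * poch b' (n - l) / (poch c' (n - l) * ((n - l)! : ℂ))) =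
      ∑ j ∈ Finset.range (n + 1), expansionCoeff c c' j (n - j) *
        (poch (a + a' + j) (n - j) * altConv (pochRatio a c) (pochRatio a' c') j) *
        (poch (b + b' + j) (n - j) * altConv (pochRatio b c) (pochRatio b' c') j) := by
  have key : ∀ l ∈ Finset.range (n + 1),
      poch a l * poch b l / (poch c l * (l ! : ℂ)) *
        (poch a' (n - l) * poch b' (n - l) / (poch c' (n - l) * ((n - l)! : ℂ))) =
      ∑ j ∈ Finset.range (n + 1), expansionCoeff c c' j (n - j) *
        (poch (a + a' + j) (n - j) * altConv (pochRatio a c) (pochRatio a' c') j) *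
        (((1 + X) ^ (n - j) * jacobiPoly c c' j).coeff l * (poch b l * poch b' (n - l))) := by
    intro l hl
    have hl' : l ≤ n := Nat.lt_succ_iff.mp (Finset.mem_range.mp hl)
    have h := congrArg (pochFunctional a a' n) (diagWeight_expansion hc hc' hg n l)
    rw [← smul_eq_C_mul, map_smul, pochFunctional_X_pow _ _ hl', smul_eq_mul, map_sum] at h
    have e : poch a l * poch b l / (poch c l * (l ! : ℂ)) *
        (poch a' (n - l) * poch b' (n - l) / (poch c' (n - l) * ((n - l)! : ℂ))) =
        diagWeight c c' n l * (poch a l * poch a' (n - l)) * (poch b l * poch b' (n - l)) := by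
      rw [diagWeight, Nat.cast_choose ℂ hl']
      have : (n ! : ℂ) ≠ 0 := by exact_mod_cast n.factorial_ne_zero
      field_simp
    rw [e, h, Finset.sum_mul]
    refine Finset.sum_congr rfl fun j hj => ?_
    rw [← smul_eq_C_mul, map_smul, smul_eq_mul,
      pochFunctional_expansion_term _ _ (Nat.lt_succ_iff.mp (Finset.mem_range.mp hj))]
    ring
  rw [Finset.sum_congr rfl key, Finset.sum_comm]
  refine Finset.sum_congr rfl fun j hj => ?_
  rw [← Finset.mul_sum, ← pochFunctional_apply,
    pochFunctional_expansion_term _ _ (Nat.lt_succ_iff.mp (Finset.mem_range.mp hj))]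

end Expansion

/-- `f` is bounded by a polynomial in `s`. -/
def PolyBounded {α : Type*} (s : α → ℕ) (f : α → ℂ) : Prop :=
  ∃ (K : ℝ) (N : ℕ), ∀ x, ‖f x‖ ≤ K * ((s x : ℝ) + 1) ^ N

/-! ### Calculus of polynomial bounds -/

namespace PolyBounded

variable {α β : Type*} {s : α → ℕ} {f g : α → ℂ}

lemma mul (hf : PolyBounded s f) (hg : PolyBounded s g) :
    PolyBounded s (fun x => f x * g x) := by
  obtain ⟨K, N, h⟩ := hf
  obtain ⟨K', N', h'⟩ := hg
  refine ⟨K * K', N + N', fun x => ?_⟩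
  calc ‖f x * g x‖ = ‖f x‖ * ‖g x‖ := norm_mul _ _
    _ ≤ (K * ((s x : ℝ) + 1) ^ N) * (K' * ((s x : ℝ) + 1) ^ N') :=
      mul_le_mul (h x) (h' x) (norm_nonneg _) ((norm_nonneg _).trans (h x))
    _ = _ := by ring

lemma comp {t : β → ℕ} (hf : PolyBounded s f) (r : β → α) (hr : ∀ y, s (r y) ≤ t y) :
    PolyBounded t (fun y => f (r y)) := by
  obtain ⟨K, N, h⟩ := hf
  refine ⟨|K|, N, fun y => (h _).trans ?_⟩
  have : (s (r y) : ℝ) ≤ t y := by exact_mod_cast hr y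
  gcongr
  exact le_abs_self K

lemma add (hf : PolyBounded s f) (hg : PolyBounded s g) :
    PolyBounded s (fun x => f x + g x) := by
  obtain ⟨K, N, h⟩ := hf
  obtain ⟨K', N', h'⟩ := hg
  refine ⟨|K| + |K'|, N + N', fun x => (norm_add_le _ _).trans ?_⟩
  have h1 : (1 : ℝ) ≤ (s x : ℝ) + 1 := by simp
  rw [add_mul]
  refine add_le_add ((h x).trans ?_) ((h' x).trans ?_)
  · gcongr
    · exact le_abs_self K
    · exact Nat.le_add_right _ _
  · gcongr
    · exact le_abs_self K'
    · exact Nat.le_add_left _ _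

lemma mono (hf : PolyBounded s f) (h : ∀ x, ‖g x‖ ≤ ‖f x‖) : PolyBounded s g := by
  obtain ⟨K, N, hK⟩ := hf
  exact ⟨K, N, fun x => (h x).trans (hK x)⟩

lemma of_bounded {K : ℝ} (h : ∀ x, ‖f x‖ ≤ K) : PolyBounded s f := ⟨K, 0, by simpa using h⟩

lemma const (s : α → ℕ) (r : ℂ) : PolyBounded s (fun _ => r) := of_bounded fun _ => le_rfl

lemma natCast (s : α → ℕ) : PolyBounded s (fun x => (s x : ℂ)) := ⟨1, 1, by simp⟩

end PolyBounded

/-! ### Growth of Pochhammer quotients -/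

section PochhammerBounds

lemma poch_one (n : ℕ) : poch 1 n = (n ! : ℂ) := by
  rw [poch, ascPochhammer_eval_one]

lemma norm_poch_le {x y : ℂ} (h : ∀ i : ℕ, ‖x + i‖ ≤ ‖y + i‖) (n : ℕ) :
    ‖poch x n‖ ≤ ‖poch y n‖ := by
  induction n with
  | zero => simp
  | succ n ih =>
    rw [poch_succ, poch_succ, norm_mul, norm_mul]
    exact mul_le_mul ih (h n) (norm_nonneg _) (norm_nonneg _)

lemma norm_add_natCast_le {x : ℂ} {E : ℕ} (h : ‖x‖ ≤ E) (i : ℕ) : ‖x + i‖ ≤ ‖(E : ℂ) + i‖ := by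
  have : ‖(E : ℂ) + i‖ = E + i := by
    rw [← Nat.cast_add, Complex.norm_natCast]; push_cast; ring
  rw [this]
  exact (norm_add_le _ _).trans (by simpa using h)

lemma polyBounded_poch_natCast (E : ℕ) :
    PolyBounded id (fun n => poch (E + 1 : ℂ) n / (n ! : ℂ)) := by
  induction E with
  | zero =>
    refine PolyBounded.of_bounded (K := 1) fun n => ?_
    have : (n ! : ℂ) ≠ 0 := by exact_mod_cast n.factorial_ne_zero
    simp [this]
  | succ E ih =>
    have hE : (E + 1 : ℂ) ≠ 0 := by exact_mod_cast E.succ_ne_zero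
    refine (ih.mul (((PolyBounded.const id (E + 1 : ℂ)).add (PolyBounded.natCast id)).mul
      (PolyBounded.const id (E + 1 : ℂ)⁻¹))).mono fun n => le_of_eq ?_
    congr 1
    have h := (poch_succ (E + 1 : ℂ) n).symm.trans (poch_succ_left (E + 1 : ℂ) n)
    push_cast
    simp only [id]
    field_simp
    linear_combination -h / (n ! : ℂ)

lemma polyBounded_poch_div_factorial (x : ℂ) :
    PolyBounded id (fun n => poch x n / (n ! : ℂ)) := by
  obtain ⟨E, hE⟩ := exists_nat_ge ‖x‖
  refine (polyBounded_poch_natCast E).mono fun n => ?_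
  rw [norm_div, norm_div]
  gcongr
  refine norm_poch_le (fun i => ?_) n
  have := norm_add_natCast_le (x := x) (E := E + 1) (hE.trans (by simp)) i
  exact_mod_cast this

/-- If `Re x ≥ 1`, then `|x + i| ≥ 1 + i` and the quotient is at most `1`. Otherwise shift `x` to `x
+ 1`, at the cost of the factor `(x + n) / x`. -/
lemma polyBounded_factorial_div_poch {x : ℂ} (hx : ∀ n : ℕ, x ≠ -(n : ℂ)) :
    PolyBounded id (fun n => (n ! : ℂ) / poch x n) := by
  obtain ⟨N, hN⟩ := exists_nat_ge (1 - x.re)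
  induction N generalizing x with
  | zero =>
    refine PolyBounded.of_bounded (K := 1) fun n => ?_
    have h0 : 0 < ‖poch x n‖ := norm_pos_iff.mpr (poch_ne_zero n fun m _ => hx m)
    rw [norm_div, div_le_one h0, ← poch_one]
    refine norm_poch_le (fun i => ?_) n
    have h1 : ‖(1 : ℂ) + i‖ = 1 + i := by
      rw [← Nat.cast_one, ← Nat.cast_add, Complex.norm_natCast]; push_cast; ring
    rw [h1]
    refine le_trans ?_ (Complex.re_le_norm _)
    simp only [Complex.add_re, Complex.natCast_re]
    simp only [Nat.cast_zero] at hN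
    linarith
  | succ N ih =>
    have hx' : ∀ n : ℕ, x + 1 ≠ -(n : ℂ) := by simpa using add_natCast_ne_neg hx 1
    have h1 := ih hx' (by simp only [Complex.add_re, Complex.one_re]; push_cast at hN; linarith)
    refine (h1.mul (((PolyBounded.const id x).add (PolyBounded.natCast id)).mul
      (PolyBounded.const id x⁻¹))).mono fun n => le_of_eq ?_
    congr 1
    have h := (poch_succ x n).symm.trans (poch_succ_left x n)
    have := poch_ne_zero n fun m _ => hx m
    have := poch_ne_zero n fun m _ => hx' m
    have : x ≠ 0 := by simpa using hx 0
    simp only [id]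
    field_simp
    linear_combination -(n ! : ℂ) * h

end PochhammerBounds

/-! ### Polynomial growth of the alternating convolutions -/

section AltConv

lemma altConv_swap (u v : ℕ → ℂ) (j : ℕ) : altConv u v j = (-1) ^ j * altConv v u j := by
  rw [altConv, ← Finset.sum_range_reflect, altConv, Finset.mul_sum]
  refine Finset.sum_congr rfl fun k hk => ?_
  obtain ⟨m, rfl⟩ := Nat.exists_eq_add_of_le (Nat.lt_succ_iff.mp (Finset.mem_range.mp hk))
  have h1 : k + m + 1 - 1 - k = m := by omega
  have h2 : k + m - m = k := by omega
  rw [h1, h2, Nat.add_sub_cancel_left]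
  have h3 : (k + m).choose m = (k + m).choose k := Nat.choose_symm_add.symm
  have h4 : (-1 : ℂ) ^ k * (-1) ^ k = 1 := by rw [← mul_pow]; simp
  rw [h3, pow_add]
  linear_combination (-(-1 : ℂ) ^ m * ((k + m).choose k : ℂ) * u m * v k) * h4

/-- Absorption, `k (j choose k) = j (j-1 choose k-1)`: a correction with factor `k` costs one factor
`j`, and the index shift flips the sign. -/
lemma altConv_add_mul {u w w' : ℕ → ℂ} {κ : ℂ} (v : ℕ → ℂ)
    (h : ∀ k, u k = w k + κ * (k * w' (k - 1))) (j : ℕ) :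
    altConv u v j = altConv w v j + -κ * (j * altConv w' v (j - 1)) := by
  rcases j with _ | j
  · simp [altConv, h]
  · have : altConv u v (j + 1) = altConv w v (j + 1) +
        ∑ k ∈ Finset.range (j + 1 + 1),
          (-1) ^ k * ((j + 1).choose k : ℂ) * (κ * (k * w' (k - 1))) * v (j + 1 - k) := by
      simp only [altConv]
      rw [← Finset.sum_add_distrib]
      refine Finset.sum_congr rfl fun k _ => ?_
      rw [h]; ring
    rw [this, Finset.sum_range_succ', altConv, altConv, Finset.mul_sum, Finset.mul_sum]
    simp only [Nat.cast_zero, zero_mul, mul_zero, add_zero, Nat.add_sub_cancel]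
    congr 1
    refine Finset.sum_congr rfl fun k _ => ?_
    have hc : ((j + 1 : ℂ)) * j.choose k = (j + 1).choose (k + 1) * (k + 1) := by
      exact_mod_cast Nat.add_one_mul_choose_eq j k
    rw [Nat.add_sub_add_right]
    push_cast
    linear_combination ((-1) ^ k * κ * w' k * v (j - k)) * hc

lemma polyBounded_altConv_of_eq {u w w' v : ℕ → ℂ} {κ : ℂ}
    (h : ∀ k, u k = w k + κ * (k * w' (k - 1))) (hw : PolyBounded id (altConv w v))
    (hw' : PolyBounded id (altConv w' v)) : PolyBounded id (altConv u v) := by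
  refine (hw.add ((PolyBounded.const id (-κ)).mul ((PolyBounded.natCast id).mul
    (hw'.comp (fun j => j - 1) fun j => Nat.sub_le j 1)))).mono fun j => le_of_eq ?_
  rw [altConv_add_mul v h]
  rfl

/-- A contiguous relation in which both new pairs have `c - a` larger by `1`. -/
lemma pochRatio_raise_right {a c : ℂ} (hc : ∀ n : ℕ, c ≠ -(n : ℂ)) (k : ℕ) :
    pochRatio a c k = pochRatio a (c + 1) k +
      a / (c * (c + 1)) * (k * pochRatio (a + 1) (c + 2) (k - 1)) := by
  have h0 : c ≠ 0 := by simpa using hc 0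
  rcases k with _ | k
  · simp [pochRatio]
  have hc1 : ∀ n : ℕ, c + 1 ≠ -(n : ℂ) := by simpa using add_natCast_ne_neg hc 1
  have h1 : c + 1 ≠ 0 := by simpa using hc1 0
  have h2 := poch_ne_zero k fun m _ => add_natCast_ne_neg hc1 1 m
  have h3 := add_natCast_ne_zero hc1 k
  have e : c + 1 + ((1 : ℕ) : ℂ) = c + 2 := by push_cast; ring
  rw [e] at h2
  have h4 : poch (c + 1) k * (c + 1 + k) = (c + 1) * poch (c + 2) k := by
    rw [← poch_succ, poch_succ_left]; congr 2; ring
  have h5 := poch_ne_zero k fun m _ => hc1 m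
  simp only [pochRatio, Nat.add_sub_cancel]
  rw [poch_succ_left a, poch_succ_left c, poch_succ (c + 1), h4]
  have h6 : poch (c + 1) k = (c + 1) * poch (c + 2) k / (c + 1 + k) := by
    rw [eq_div_iff h3, h4]
  rw [h6]
  push_cast
  field_simp
  ring

/-- A contiguous relation in which both new pairs have `a` larger by `1`. -/
lemma pochRatio_raise_both {a c : ℂ} (hc : ∀ n : ℕ, c ≠ -(n : ℂ)) (k : ℕ) :
    pochRatio a c k = pochRatio (a + 1) (c + 1) k +
      -((c - a) / (c * (c + 1))) * (k * pochRatio (a + 1) (c + 2) (k - 1)) := by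
  have h0 : c ≠ 0 := by simpa using hc 0
  rcases k with _ | k
  · simp [pochRatio]
  have hc1 : ∀ n : ℕ, c + 1 ≠ -(n : ℂ) := by simpa using add_natCast_ne_neg hc 1
  have h1 : c + 1 ≠ 0 := by simpa using hc1 0
  have h2 := poch_ne_zero k fun m _ => add_natCast_ne_neg hc1 1 m
  have h3 := add_natCast_ne_zero hc1 k
  have e : c + 1 + ((1 : ℕ) : ℂ) = c + 2 := by push_cast; ring
  rw [e] at h2
  have h4 : poch (c + 1) k * (c + 1 + k) = (c + 1) * poch (c + 2) k := by
    rw [← poch_succ, poch_succ_left]; congr 2; ring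
  simp only [pochRatio, Nat.add_sub_cancel]
  rw [poch_succ_left a, poch_succ_left c, poch_succ (c + 1), h4, poch_succ (a + 1)]
  have h6 : poch (c + 1) k = (c + 1) * poch (c + 2) k / (c + 1 + k) := by
    rw [eq_div_iff h3, h4]
  rw [h6]
  push_cast
  field_simp
  ring

/-- `u` is the sequence of moments of an integrable density on `[0, 1]`. -/
def IsMomentSeq (u : ℕ → ℂ) : Prop :=
  ∃ w : ℝ → ℂ, IntervalIntegrable w MeasureTheory.volume 0 1 ∧
    ∀ k : ℕ, u k = ∫ x in (0 : ℝ)..1, (x : ℂ) ^ k * w x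

/-- The density is the normalized beta density `x^(a-1) (1-x)^(c-a-1) / B(a, c-a)`. -/
lemma isMomentSeq_pochRatio {a c : ℂ} (ha : 0 < a.re) (hac : a.re < c.re) :
    IsMomentSeq (pochRatio a c) := by
  have hb : 0 < (c - a).re := by simpa using hac
  have hc : 0 < c.re := ha.trans hac
  have hne : ∀ {x : ℂ}, 0 < x.re → ∀ n : ℕ, x ≠ -(n : ℂ) := by
    rintro x hx n rfl
    simp only [Complex.neg_re, Complex.natCast_re] at hx
    have : (0 : ℝ) ≤ n := n.cast_nonneg
    linarith
  set B := Complex.betaIntegral a (c - a) with hB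
  refine ⟨fun x => B⁻¹ * ((x : ℂ) ^ (a - 1) * (1 - (x : ℂ)) ^ (c - a - 1)),
    (Complex.betaIntegral_convergent ha hb).const_mul _, fun k => ?_⟩
  have hak : 0 < (a + k).re := by
    simp only [Complex.add_re, Complex.natCast_re]; positivity
  have h1 : ∫ x in (0 : ℝ)..1, (x : ℂ) ^ k * (B⁻¹ * ((x : ℂ) ^ (a - 1) *
      (1 - (x : ℂ)) ^ (c - a - 1))) = B⁻¹ * Complex.betaIntegral (a + k) (c - a) := by
    rw [Complex.betaIntegral, ← intervalIntegral.integral_const_mul]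
    refine intervalIntegral.integral_congr_ae (Filter.Eventually.of_forall fun x hx => ?_)
    rw [Set.uIoc_of_le zero_le_one] at hx
    have hx0 : (x : ℂ) ≠ 0 := by exact_mod_cast hx.1.ne'
    have : a + k - 1 = k + (a - 1) := by ring
    rw [this, Complex.cpow_add _ _ hx0, Complex.cpow_natCast]
    ring
  have e1 : a + k + (c - a) = c + k := by ring
  have e2 : a + (c - a) = c := by ring
  rw [h1, hB, Complex.betaIntegral_eq_Gamma_mul_div _ _ ha hb,
    Complex.betaIntegral_eq_Gamma_mul_div _ _ hak hb, e1, e2, pochRatio, poch, poch,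
    ← Complex.Gamma_add_nat_div_Gamma_eq a (hne ha),
    ← Complex.Gamma_add_nat_div_Gamma_eq c (hne hc)]
  have := Complex.Gamma_ne_zero_of_re_pos ha
  have := Complex.Gamma_ne_zero_of_re_pos hb
  have := Complex.Gamma_ne_zero_of_re_pos hc
  have : Complex.Gamma (c + k) ≠ 0 := Complex.Gamma_ne_zero_of_re_pos (by
    simp only [Complex.add_re, Complex.natCast_re]; positivity)
  field_simp

/-- By the binomial theorem the convolution is the double integral of `(y - x)^j` against the two
densities, and `|y - x| ≤ 1` on the unit square. -/
lemma IsMomentSeq.polyBounded_altConv {u v : ℕ → ℂ} (hu : IsMomentSeq u) (hv : IsMomentSeq v) :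
    PolyBounded id (altConv u v) := by
  obtain ⟨w, hw, hu⟩ := hu
  obtain ⟨w', hw', hv⟩ := hv
  have hint : ∀ {w : ℝ → ℂ}, IntervalIntegrable w MeasureTheory.volume 0 1 → ∀ p : ℝ → ℂ,
      Continuous p → IntervalIntegrable (fun x => p x * w x) MeasureTheory.volume 0 1 :=
    fun hw p hp => hw.continuousOn_mul hp.continuousOn
  have hle : ∀ {w : ℝ → ℂ}, IntervalIntegrable w MeasureTheory.volume 0 1 → ∀ {p : ℝ → ℂ} {K : ℝ},
      (∀ x ∈ Set.Ioc (0 : ℝ) 1, ‖p x‖ ≤ K) →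
      ‖∫ x in (0 : ℝ)..1, p x * w x‖ ≤ K * ∫ x in (0 : ℝ)..1, ‖w x‖ := by
    intro w hw p K h
    rw [← intervalIntegral.integral_const_mul]
    refine intervalIntegral.norm_integral_le_of_norm_le zero_le_one
      (Filter.Eventually.of_forall fun x hx => ?_) (hw.norm.const_mul K)
    rw [norm_mul]
    exact mul_le_mul_of_nonneg_right (h x hx) (norm_nonneg _)
  refine PolyBounded.of_bounded
    (K := (1 * ∫ x in (0 : ℝ)..1, ‖w' x‖) * ∫ x in (0 : ℝ)..1, ‖w x‖) fun j => ?_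
  have h1 : altConv u v j = ∫ x in (0 : ℝ)..1, (∑ k ∈ Finset.range (j + 1),
      (-1) ^ k * (j.choose k : ℂ) * (x : ℂ) ^ k * v (j - k)) * w x := by
    simp only [Finset.sum_mul]
    rw [intervalIntegral.integral_finsetSum fun k _ => hint hw _ (by fun_prop), altConv]
    refine Finset.sum_congr rfl fun k _ => ?_
    rw [hu, ← intervalIntegral.integral_const_mul, ← intervalIntegral.integral_mul_const]
    congr 1
    ext x
    ring
  have h2 : ∀ x : ℝ, ∑ k ∈ Finset.range (j + 1),
      (-1) ^ k * (j.choose k : ℂ) * (x : ℂ) ^ k * v (j - k) =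
      ∫ y in (0 : ℝ)..1, (-(x : ℂ) + y) ^ j * w' y := by
    intro x
    simp only [add_pow, Finset.sum_mul]
    rw [intervalIntegral.integral_finsetSum fun k _ => hint hw' _ (by fun_prop)]
    refine Finset.sum_congr rfl fun k _ => ?_
    rw [hv, ← intervalIntegral.integral_const_mul]
    congr 1
    ext y
    rw [neg_pow]
    ring
  rw [h1]
  refine hle hw fun x hx => ?_
  rw [h2]
  refine hle hw' fun y hy => ?_
  rw [norm_pow]
  refine pow_le_one₀ (norm_nonneg _) ?_
  rw [← Complex.ofReal_neg, ← Complex.ofReal_add, Complex.norm_real, Real.norm_eq_abs, abs_le]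
  constructor <;> linarith [hx.1, hx.2, hy.1, hy.2]

/-- Raise `a` until `Re a > 0`, then the gap `c - a` until `Re a < Re c`; finitely many steps, each
costing one power of `j`. -/
lemma polyBounded_altConv_of_base {v : ℕ → ℂ}
    (base : ∀ a c : ℂ, 0 < a.re → a.re < c.re → PolyBounded id (altConv (pochRatio a c) v))
    {a c : ℂ} (hc : ∀ n : ℕ, c ≠ -(n : ℂ)) : PolyBounded id (altConv (pochRatio a c) v) := by
  have shift : ∀ {c : ℂ}, (∀ n : ℕ, c ≠ -(n : ℂ)) →
      (∀ n : ℕ, c + 1 ≠ -(n : ℂ)) ∧ ∀ n : ℕ, c + 2 ≠ -(n : ℂ) := fun hc =>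
    ⟨by simpa using add_natCast_ne_neg hc 1, by simpa using add_natCast_ne_neg hc 2⟩
  have right : ∀ (N : ℕ) (a c : ℂ), (∀ n : ℕ, c ≠ -(n : ℂ)) → 0 < a.re → a.re < c.re + N →
      PolyBounded id (altConv (pochRatio a c) v) := by
    intro N
    induction N with
    | zero => intro a c _ ha h; exact base a c ha (by simpa using h)
    | succ N ih =>
      intro a c hc ha h
      push_cast at h
      refine polyBounded_altConv_of_eq (pochRatio_raise_right hc)
        (ih a (c + 1) (shift hc).1 ha ?_) (ih (a + 1) (c + 2) (shift hc).2 ?_ ?_)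
      all_goals simp only [Complex.add_re, Complex.one_re, Complex.re_ofNat]; linarith
  have both : ∀ (N : ℕ) (a c : ℂ), (∀ n : ℕ, c ≠ -(n : ℂ)) → 0 < a.re + N →
      PolyBounded id (altConv (pochRatio a c) v) := by
    intro N
    induction N with
    | zero =>
      intro a c hc ha
      obtain ⟨M, hM⟩ := exists_nat_gt (a.re - c.re)
      exact right M a c hc (by simpa using ha) (by linarith)
    | succ N ih =>
      intro a c hc ha
      push_cast at ha
      refine polyBounded_altConv_of_eq (pochRatio_raise_both hc)
        (ih (a + 1) (c + 1) (shift hc).1 ?_) (ih (a + 1) (c + 2) (shift hc).2 ?_)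
      all_goals simp only [Complex.add_re, Complex.one_re]; linarith
  obtain ⟨N, hN⟩ := exists_nat_gt (-a.re)
  exact both N a c hc (by linarith)

/-- The terminating sums `∑ (-1)^k (j choose k) (a)_k (a')_{j-k} / ((c)_k (c')_{j-k})` grow at most
polynomially in `j`. -/
theorem polyBounded_altConv_pochRatio {c c' : ℂ} (hc : ∀ n : ℕ, c ≠ -(n : ℂ))
    (hc' : ∀ n : ℕ, c' ≠ -(n : ℂ)) (a a' : ℂ) :
    PolyBounded id (altConv (pochRatio a c) (pochRatio a' c')) := by
  refine polyBounded_altConv_of_base (fun b d hb hd => ?_) hc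
  have h : PolyBounded id (altConv (pochRatio a' c') (pochRatio b d)) :=
    polyBounded_altConv_of_base (fun b' d' hb' hd' =>
      (isMomentSeq_pochRatio hb' hd').polyBounded_altConv (isMomentSeq_pochRatio hb hd)) hc'
  refine h.mono fun j => ?_
  rw [altConv_swap]
  simp

end AltConv

/-! ### The two forms of the coefficient -/

section Coefficients

lemma poch_mul_hyp₃F₂ {e : ℂ} {j : ℕ} (he : NoZeroBelow e j) (a s c : ℂ) :
    poch e j * hyp₃F₂ (-(j : ℂ)) a s e c 1 = clearedHyp₃F₂ j a s e c := by
  rw [hyp₃F₂, tsum_eq_sum (s := Finset.range (j + 1)), clearedHyp₃F₂, Finset.mul_sum]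
  · refine Finset.sum_congr rfl fun k hk => ?_
    obtain ⟨m, rfl⟩ := Nat.exists_eq_add_of_le (Nat.lt_succ_iff.mp (Finset.mem_range.mp hk))
    have h : poch e k ≠ 0 := poch_ne_zero k fun i hi => he i (by omega)
    rw [poch_add, Nat.add_sub_cancel_left, one_pow, mul_one]
    simp only [div_eq_mul_inv, mul_inv]
    field_simp
  -- Beyond `j` the numerator contains `(-j)_k = 0`, so the term is zero even if the denominator
  -- vanishes.
  · intro k hk
    rw [poch_neg_natCast_eq_zero (by simpa using hk)]
    simp

lemma multCoeff_eq_quotientCoeff {a b a' b' : ℂ} {j : ℕ} (ha : NoZeroBelow (a + a') j)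
    (hb : NoZeroBelow (b + b') j) (c c' : ℂ) :
    multCoeff a b c a' b' c' j = quotientCoeff a b c a' b' c' j := by
  rw [multCoeff, quotientCoeff, ← poch_mul_hyp₃F₂ ha, ← poch_mul_hyp₃F₂ hb]
  ring

lemma continuous_poch (n : ℕ) : Continuous fun x : ℂ => poch x n :=
  (ascPochhammer ℂ n).continuous

lemma continuous_clearedHyp₃F₂ (j : ℕ) (s c : ℂ) :
    Continuous fun p : ℂ × ℂ => clearedHyp₃F₂ j p.1 s p.2 c := by
  unfold clearedHyp₃F₂
  refine continuous_finsetSum _ fun k _ => Continuous.div_const ?_ _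
  exact ((continuous_const.mul ((continuous_poch k).comp continuous_fst)).mul
    continuous_const).mul ((continuous_poch (j - k)).comp (continuous_snd.add continuous_const))

lemma continuous_multCoeff (c c' : ℂ) (j : ℕ) : Continuous fun p : ℂ × ℂ × ℂ × ℂ =>
    multCoeff p.1 p.2.1 c p.2.2.1 p.2.2.2 c' j := by
  unfold multCoeff
  refine (continuous_const.mul ?_).mul ?_
  · exact (continuous_clearedHyp₃F₂ j (c + c' + j - 1) c).comp
      (f := fun p : ℂ × ℂ × ℂ × ℂ => (p.1, p.1 + p.2.2.1)) (by fun_prop)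
  · exact (continuous_clearedHyp₃F₂ j (c + c' + j - 1) c).comp
      (f := fun p : ℂ × ℂ × ℂ × ℂ => (p.2.1, p.2.1 + p.2.2.2)) (by fun_prop)

lemma multCoeff_mul_coeff {c c' : ℂ} (hc : ∀ n : ℕ, c ≠ -(n : ℂ)) (hc' : ∀ n : ℕ, c' ≠ -(n : ℂ))
    (a b a' b' : ℂ) (j m : ℕ) :
    multCoeff a b c a' b' c' j * (poch (a + a' + j) m * poch (b + b' + j) m /
        (poch (c + c' + 2 * j) m * (m ! : ℂ))) =
      expansionCoeff c c' j m *
        (poch (a + a' + j) m * altConv (pochRatio a c) (pochRatio a' c') j) *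
        (poch (b + b' + j) m * altConv (pochRatio b c) (pochRatio b' c') j) := by
  rw [multCoeff, clearedHyp_eq_altConv hc hc', clearedHyp_eq_altConv hc hc', expansionCoeff]
  have := poch_ne_zero j fun m _ => hc' m
  generalize altConv (pochRatio a c) (pochRatio a' c') j = S
  generalize altConv (pochRatio b c) (pochRatio b' c') j = T
  generalize poch c' j = P at *
  generalize poch c j = Q
  generalize poch (c + c' + j - 1) j = A
  generalize poch (c + c' + 2 * j) m = B
  generalize poch (a + a' + j) m = U
  generalize poch (b + b' + j) m = V
  field_simp

end Coefficients

/-! ### Absolute convergence of the double series -/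

section Bounds

/-- The central binomial coefficient of `2(j + m)` dominates the others in its row. -/
lemma factorial_add_mul_self_le (j m : ℕ) :
    (j + m)! * (j + m)! ≤ (2 * j + m)! * m ! := by
  have h1 := Nat.choose_mul_factorial_mul_factorial (show m ≤ 2 * (j + m) by omega)
  have h2 := Nat.choose_mul_factorial_mul_factorial (show j + m ≤ 2 * (j + m) by omega)
  rw [show 2 * (j + m) - m = 2 * j + m by omega] at h1
  rw [show 2 * (j + m) - (j + m) = j + m by omega] at h2
  have h3 : (2 * (j + m)).choose m ≤ (2 * (j + m)).choose (j + m) := Nat.choose_le_centralBinom m _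
  have h4 : 0 < (2 * (j + m)).choose (j + m) := Nat.choose_pos (by omega)
  refine Nat.le_of_mul_le_mul_left ?_ h4
  calc (2 * (j + m)).choose (j + m) * ((j + m)! * (j + m)!)
      = (2 * (j + m)).choose m * ((2 * j + m)! * m !) := by
        rw [← mul_assoc, h2, ← h1]; ring
    _ ≤ _ := Nat.mul_le_mul_right _ h3

/-- Replacing `e` by an integer `E + 1 > ‖e‖` makes `(E + 1)_j` nonzero, so `(E + 1 + j)_m = (E +
1)_(j+m) / (E + 1)_j` splits the bound. -/
lemma polyBounded_poch_shift (e : ℂ) : PolyBounded (fun p : ℕ × ℕ => 2 * p.1 + p.2)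
    (fun p => poch (e + p.1) p.2 * (p.1 ! : ℂ) / ((p.1 + p.2)! : ℂ)) := by
  obtain ⟨E, hE⟩ := exists_nat_ge ‖e‖
  have hne : ∀ n : ℕ, (E + 1 : ℂ) ≠ -(n : ℂ) := fun n h => by
    have : (E + 1 + n : ℂ) ≠ 0 := by exact_mod_cast (by omega : E + 1 + n ≠ 0)
    exact this (by rw [h]; ring)
  refine (((polyBounded_poch_div_factorial (E + 1)).comp (fun p : ℕ × ℕ => p.1 + p.2)
    (t := fun p => 2 * p.1 + p.2) fun p => by simp only [id]; omega).mul
    ((polyBounded_factorial_div_poch hne).comp (fun p : ℕ × ℕ => p.1)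
      fun p => by simp only [id]; omega)).mono ?_
  rintro ⟨j, m⟩
  have h1 : poch (E + 1 : ℂ) j ≠ 0 := poch_ne_zero j fun i _ => hne i
  have h2 : poch (E + 1 : ℂ) (j + m) / ((j + m)! : ℂ) * ((j ! : ℂ) / poch (E + 1 : ℂ) j) =
      poch (E + 1 + j : ℂ) m * (j ! : ℂ) / ((j + m)! : ℂ) := by
    rw [poch_add]; field_simp
  simp only
  rw [h2, norm_div, norm_div, norm_mul, norm_mul]
  gcongr
  refine norm_poch_le (fun i => ?_) m
  have := norm_add_natCast_le (x := e) (E := E + 1) (hE.trans (by simp)) (j + i)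
  push_cast at this
  simpa only [add_assoc] using this

lemma polyBounded_denominator {g : ℂ} (hg : ∀ n : ℕ, g ≠ -(n : ℂ)) :
    PolyBounded (fun p : ℕ × ℕ => 2 * p.1 + p.2) (fun p => ((2 * p.1 + p.2)! : ℂ) /
      ((p.1 ! : ℂ) * (poch (g + p.1 - 1) p.1 * poch (g + 2 * p.1) p.2))) := by
  obtain ⟨E, hE⟩ := exists_nat_ge ‖g‖
  refine ((((polyBounded_factorial_div_poch hg).comp (fun p : ℕ × ℕ => 2 * p.1 + p.2)
    (t := fun p => 2 * p.1 + p.2) fun p => le_rfl).mul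
    ((polyBounded_poch_div_factorial g).comp (fun p : ℕ × ℕ => p.1 - 1)
      fun p => by simp only [id]; omega)).mul (PolyBounded.const _ (E + 2 : ℂ))).mono ?_
  have hE2 : ‖(E + 2 : ℂ)‖ = E + 2 := by
    rw [← Nat.cast_ofNat (R := ℂ), ← Nat.cast_add, Complex.norm_natCast]; push_cast; ring
  rintro ⟨j, m⟩
  rcases j with _ | i
  · simp only [Nat.zero_sub, poch_zero, Nat.factorial_zero, Nat.cast_one, div_one, mul_one,
      mul_zero, zero_add, Nat.cast_zero, add_zero, one_mul]
    rw [norm_mul, hE2]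
    refine le_mul_of_one_le_right (norm_nonneg _) ?_
    have : (0 : ℝ) ≤ E := E.cast_nonneg
    linarith
  · have e1 : poch g (2 * (i + 1) + m) = poch g i * poch (g + (i + 1 : ℕ) - 1) (i + 1) *
        ((g + (2 * i + 1 : ℕ)) * poch (g + 2 * (i + 1 : ℕ)) m) := by
      rw [show 2 * (i + 1) + m = i + (i + 1) + (1 + m) by ring, poch_add, poch_add g i,
        add_comm 1 m, poch_succ_left (g + (i + (i + 1) : ℕ))]
      have i1 : g + (i + (i + 1) : ℕ) = g + (2 * i + 1 : ℕ) := by push_cast; ring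
      have i2 : g + (2 * i + 1 : ℕ) + 1 = g + 2 * (i + 1 : ℕ) := by push_cast; ring
      have i3 : g + (i + 1 : ℕ) - 1 = g + i := by push_cast; ring
      rw [i1, i2, i3, mul_assoc]
    have h1 := poch_ne_zero i fun m _ => hg m
    have h2 := poch_add_sub_one_ne_zero hg (i + 1)
    have h3 := poch_add_two_mul_ne_zero hg (i + 1) m
    have h4 := add_natCast_ne_zero hg (2 * i + 1)
    have h5 : (i ! : ℂ) ≠ 0 := by exact_mod_cast i.factorial_ne_zero
    have h6 : (i + 1 : ℂ) ≠ 0 := by exact_mod_cast i.succ_ne_zero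
    have e2 : ((2 * (i + 1) + m)! : ℂ) / (((i + 1)! : ℂ) *
        (poch (g + (i + 1 : ℕ) - 1) (i + 1) * poch (g + 2 * (i + 1 : ℕ)) m)) =
        ((2 * (i + 1) + m)! : ℂ) / poch g (2 * (i + 1) + m) * (poch g i / (i ! : ℂ)) *
          ((g + (2 * i + 1 : ℕ)) / (i + 1)) := by
      rw [e1, Nat.factorial_succ i]
      generalize poch (g + (i + 1 : ℕ) - 1) (i + 1) = A at *
      generalize poch (g + 2 * (i + 1 : ℕ)) m = B at *
      generalize g + (2 * i + 1 : ℕ) = D at *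
      push_cast
      field_simp
    simp only [Nat.add_sub_cancel]
    rw [e2, norm_mul, norm_mul _ (E + 2 : ℂ), hE2]
    refine mul_le_mul_of_nonneg_left ?_ (norm_nonneg _)
    have h7 : ‖(i + 1 : ℂ)‖ = i + 1 := by
      rw [← Nat.cast_one (R := ℂ), ← Nat.cast_add, Complex.norm_natCast]; push_cast; ring
    have hi : (0 : ℝ) ≤ i := i.cast_nonneg
    have hE0 : (0 : ℝ) ≤ E := E.cast_nonneg
    rw [norm_div, h7, div_le_iff₀ (by positivity)]
    have h8 := norm_add_le g ((2 * i + 1 : ℕ) : ℂ)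
    rw [Complex.norm_natCast] at h8
    push_cast at h8 ⊢
    nlinarith [mul_nonneg hE0 hi]

theorem polyBounded_expansion_terms {c c' : ℂ} (hc : ∀ n : ℕ, c ≠ -(n : ℂ))
    (hc' : ∀ n : ℕ, c' ≠ -(n : ℂ)) (hg : ∀ n : ℕ, c + c' ≠ -(n : ℂ)) (a b a' b' : ℂ) :
    PolyBounded (fun p : ℕ × ℕ => 2 * p.1 + p.2) (fun p => expansionCoeff c c' p.1 p.2 *
        (poch (a + a' + p.1) p.2 * altConv (pochRatio a c) (pochRatio a' c') p.1) *
        (poch (b + b' + p.1) p.2 * altConv (pochRatio b c) (pochRatio b' c') p.1)) := by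
  have fst : ∀ {f : ℕ → ℂ}, PolyBounded id f →
      PolyBounded (fun p : ℕ × ℕ => 2 * p.1 + p.2) (fun p => f p.1) := fun hf =>
    hf.comp (fun p : ℕ × ℕ => p.1) fun p => by simp only [id]; omega
  have hR : PolyBounded (fun p : ℕ × ℕ => 2 * p.1 + p.2) (fun p =>
      (((p.1 + p.2)! * (p.1 + p.2)! : ℕ) : ℂ) / (((2 * p.1 + p.2)! * p.2 ! : ℕ) : ℂ)) := by
    refine PolyBounded.of_bounded (K := 1) fun p => ?_
    rw [norm_div, Complex.norm_natCast, Complex.norm_natCast]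
    refine div_le_one_of_le₀ ?_ (Nat.cast_nonneg _)
    exact_mod_cast factorial_add_mul_self_le p.1 p.2
  refine ((((((((fst (polyBounded_poch_div_factorial c)).mul
    (fst (polyBounded_poch_div_factorial c'))).mul (polyBounded_denominator hg)).mul
    (polyBounded_poch_shift (a + a'))).mul (polyBounded_poch_shift (b + b'))).mul
    (fst (polyBounded_altConv_pochRatio hc hc' a a'))).mul
    (fst (polyBounded_altConv_pochRatio hc hc' b b'))).mul hR).mono ?_
  rintro ⟨j, m⟩
  refine le_of_eq (congrArg norm ?_)
  have h1 : (j ! : ℂ) ≠ 0 := by exact_mod_cast j.factorial_ne_zero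
  have h2 : (m ! : ℂ) ≠ 0 := by exact_mod_cast m.factorial_ne_zero
  have h3 : ((j + m)! : ℂ) ≠ 0 := by exact_mod_cast (j + m).factorial_ne_zero
  have h4 : ((2 * j + m)! : ℂ) ≠ 0 := by exact_mod_cast (2 * j + m).factorial_ne_zero
  have h5 := poch_add_sub_one_ne_zero hg j
  have h6 := poch_add_two_mul_ne_zero hg j m
  simp only [expansionCoeff]
  generalize poch (c + c' + j - 1) j = A at *
  generalize poch (c + c' + 2 * j) m = B at *
  push_cast
  field_simp

lemma polyBounded_hypergeometric_coeff {c : ℂ} (hc : ∀ n : ℕ, c ≠ -(n : ℂ)) (a b : ℂ) :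
    PolyBounded id (fun n => poch a n * poch b n / (poch c n * (n ! : ℂ))) := by
  refine (((polyBounded_poch_div_factorial a).mul (polyBounded_poch_div_factorial b)).mul
    (polyBounded_factorial_div_poch hc)).mono fun n => le_of_eq (congrArg norm ?_)
  have : (n ! : ℂ) ≠ 0 := by exact_mod_cast n.factorial_ne_zero
  field_simp

lemma summable_add_one_pow_mul_geometric (N : ℕ) {r : ℝ} (h0 : 0 ≤ r) (h1 : r < 1) :
    Summable fun n : ℕ => ((n : ℝ) + 1) ^ N * r ^ n := by
  -- A ratio `ρ > r` is positive even if `r = 0`, so the index shift can be undone by dividing by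
  -- `ρ`.
  obtain ⟨ρ, hρ, hρ1⟩ := exists_between h1
  have hρ0 : 0 < ρ := h0.trans_lt hρ
  have h := (summable_nat_add_iff 1).mpr (summable_pow_mul_geometric_of_norm_lt_one (R := ℝ) N
    (by rwa [Real.norm_of_nonneg hρ0.le] : ‖ρ‖ < 1))
  refine (h.mul_right ρ⁻¹).of_nonneg_of_le (fun n => by positivity) fun n => ?_
  rw [pow_succ, mul_assoc, mul_assoc, mul_inv_cancel₀ hρ0.ne', mul_one]
  push_cast
  gcongr

lemma PolyBounded.summable_norm {f : ℕ → ℂ} (hf : PolyBounded id f) {z : ℂ} (hz : ‖z‖ < 1) :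
    Summable fun n => ‖f n * z ^ n‖ := by
  obtain ⟨K, N, h⟩ := hf
  refine ((summable_add_one_pow_mul_geometric N (norm_nonneg z) hz).mul_left K).of_nonneg_of_le
    (fun n => norm_nonneg _) fun n => ?_
  rw [norm_mul, norm_pow, ← mul_assoc]
  exact mul_le_mul_of_nonneg_right (h n) (by positivity)

lemma PolyBounded.summable_prod {f : ℕ × ℕ → ℂ}
    (hf : PolyBounded (fun p : ℕ × ℕ => 2 * p.1 + p.2) f) {z : ℂ} (hz : ‖z‖ < 1) :
    Summable fun p : ℕ × ℕ => f p * z ^ (p.1 + p.2) := by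
  obtain ⟨K, N, h⟩ := hf
  have hs := summable_add_one_pow_mul_geometric N (norm_nonneg z) hz
  refine Summable.of_norm_bounded ((hs.mul_of_nonneg hs (fun n => by positivity)
    fun n => by positivity).mul_left (|K| * 2 ^ N)) fun p => ?_
  rw [norm_mul, norm_pow]
  -- This separates the variables, so a product of two single series is a majorant.
  have h1 : ((2 * p.1 + p.2 : ℕ) : ℝ) + 1 ≤ 2 * ((p.1 + 1) * (p.2 + 1)) := by
    push_cast
    have : (0 : ℝ) ≤ (p.1 : ℝ) * p.2 := by positivity
    have : (0 : ℝ) ≤ p.2 := by positivity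
    nlinarith
  calc ‖f p‖ * ‖z‖ ^ (p.1 + p.2)
      ≤ |K| * (2 * (((p.1 : ℝ) + 1) * (p.2 + 1))) ^ N * ‖z‖ ^ (p.1 + p.2) := by
        refine mul_le_mul_of_nonneg_right ((h p).trans ?_) (by positivity)
        gcongr
        exact le_abs_self K
    _ = _ := by rw [mul_pow, mul_pow, pow_add]; ring

end Bounds

/-! ### Summation by rows and by antidiagonals -/

lemma hypergeometric_eq_tsum (a b c z : ℂ) :
    ₂F₁ a b c z = ∑' n : ℕ, poch a n * poch b n / (poch c n * (n ! : ℂ)) * z ^ n := by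
  rw [ordinaryHypergeometric_eq_tsum]
  refine tsum_congr fun n => ?_
  simp only [poch, smul_eq_mul, div_eq_mul_inv, mul_inv]
  ring

theorem hasSum_multCoeff {c c' z : ℂ} (hc : ∀ n : ℕ, c ≠ -(n : ℂ)) (hc' : ∀ n : ℕ, c' ≠ -(n : ℂ))
    (hcc' : ∀ n : ℕ, c + c' ≠ -(n : ℂ)) (hz : ‖z‖ < 1) (a b a' b' : ℂ) :
    HasSum (fun j : ℕ => multCoeff a b c a' b' c' j * z ^ j *
        ₂F₁ (a + a' + j) (b + b' + j) (c + c' + 2 * j) z)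
      (₂F₁ a b c z * ₂F₁ a' b' c' z) := by
  set F : ℕ × ℕ → ℂ := fun p => expansionCoeff c c' p.1 p.2 *
    (poch (a + a' + p.1) p.2 * altConv (pochRatio a c) (pochRatio a' c') p.1) *
    (poch (b + b' + p.1) p.2 * altConv (pochRatio b c) (pochRatio b' c') p.1) *
    z ^ (p.1 + p.2) with hF
  have hFs : Summable F := (polyBounded_expansion_terms hc hc' hcc' a b a' b').summable_prod hz
  have hrow : ∀ j, ∑' m, F (j, m) = multCoeff a b c a' b' c' j * z ^ j *
      ₂F₁ (a + a' + j) (b + b' + j) (c + c' + 2 * j) z := by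
    intro j
    rw [hypergeometric_eq_tsum, ← tsum_mul_left]
    refine tsum_congr fun m => ?_
    simp only [hF]
    rw [← multCoeff_mul_coeff hc hc', pow_add]
    ring
  have hprod : ₂F₁ a b c z * ₂F₁ a' b' c' z = ∑' p, F p := by
    have hσ := (Finset.HasAntidiagonal.sigmaAntidiagonalEquivProd.summable_iff.mpr hFs).tsum_sigma
    simp only [Function.comp_apply] at hσ
    rw [hypergeometric_eq_tsum, hypergeometric_eq_tsum,
      tsum_mul_tsum_eq_tsum_sum_antidiagonal_of_summable_norm
        ((polyBounded_hypergeometric_coeff hc a b).summable_norm hz)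
        ((polyBounded_hypergeometric_coeff hc' a' b').summable_norm hz),
      ← Equiv.tsum_eq Finset.HasAntidiagonal.sigmaAntidiagonalEquivProd F,
      hσ]
    refine tsum_congr fun n => ?_
    have hR : ∑' p : Finset.HasAntidiagonal.antidiagonal n,
        F (Finset.HasAntidiagonal.sigmaAntidiagonalEquivProd ⟨n, p⟩) =
        ∑ p ∈ Finset.HasAntidiagonal.antidiagonal n, F p := by
      rw [tsum_fintype]
      exact Finset.sum_coe_sort _ F
    refine Eq.trans ?_ hR.symm
    rw [Finset.Nat.sum_antidiagonal_eq_sum_range_succ_mk,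
      Finset.Nat.sum_antidiagonal_eq_sum_range_succ_mk]
    have h := congrArg (· * z ^ n) (sum_coeff_mul_coeff hc hc' hcc' a a' b b' n)
    simp only [Finset.sum_mul] at h
    refine Eq.trans (Finset.sum_congr rfl fun k hk => ?_)
      (h.trans (Finset.sum_congr rfl fun k hk => ?_))
    all_goals
      obtain ⟨m, rfl⟩ := Nat.exists_eq_add_of_le (Nat.lt_succ_iff.mp (Finset.mem_range.mp hk))
      simp only [hF, Nat.add_sub_cancel_left]
    rw [pow_add]
    ring
  rw [hprod]
  have h := hFs.hasSum.prod_fiberwise fun j => (hFs.prod_factor j).hasSum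
  simpa only [hrow] using h

theorem mainTheorem2 (a b c a' b' c' z : ℂ)
    (hc : ∀ n : ℕ, c ≠ -(n : ℂ)) (hc' : ∀ n : ℕ, c' ≠ -(n : ℂ))
    (hcc' : ∀ n : ℕ, c + c' ≠ -(n : ℂ)) (hz : ‖z‖ < 1) :
    (∀ j : ℕ, NoZeroBelow (a + a') j → NoZeroBelow (b + b') j →
      multCoeff a b c a' b' c' j = quotientCoeff a b c a' b' c' j) ∧
    (∀ j : ℕ, Tendsto
      (fun p : ℂ × ℂ × ℂ × ℂ => quotientCoeff p.1 p.2.1 c p.2.2.1 p.2.2.2 c' j)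
      (𝓝[{p : ℂ × ℂ × ℂ × ℂ |
        NoZeroBelow (p.1 + p.2.2.1) j ∧ NoZeroBelow (p.2.1 + p.2.2.2) j}] (a, b, a', b'))
      (𝓝 (multCoeff a b c a' b' c' j))) ∧
    HasSum
      (fun j : ℕ => multCoeff a b c a' b' c' j * z ^ j *
        ₂F₁ (a + a' + j) (b + b' + j) (c + c' + 2 * j) z)
      (₂F₁ a b c z * ₂F₁ a' b' c' z) := by
  refine ⟨fun j ha hb => multCoeff_eq_quotientCoeff ha hb c c', fun j => ?_,
    hasSum_multCoeff hc hc' hcc' hz a b a' b'⟩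
  refine tendsto_nhdsWithin_congr (fun p hp => multCoeff_eq_quotientCoeff hp.1 hp.2 c c') ?_
  exact ((continuous_multCoeff c c' j).tendsto (a, b, a', b')).mono_left nhdsWithin_le_nhds
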